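/- Let $\mathcal X$ be a finite alphabet and let $\theta=(\theta_x)_{x\in\mathcal X}$ be a probability vector with $\theta_x>0$ for all $x$ that is not the uniform vector $u=(1/|\mathcal X|,\dots,1/|\mathcal X|)$ (hence $|\mathcal X|\ge 2$). Logarithms are natural, $H(\theta)=\sum_x\theta_x\log(1/\theta_x)$, and $\eta=H(\theta)/\log|\mathcal X|$. For a source $\mu\in\{\theta,u\}$ let $X^n$ be a string of $n$ i.i.d. letters with distribution $\mu$, and let $G^n_\mu(X^n)\in\{1,\dots,|\mathcal X|^n\}$ be the number of guesses needed to find $X^n$ when all strings are queried one by one in order of decreasing probability under $\mu$ (ties broken arbitrarily). For each of the two sources the sequence $\frac1n\log G^n_\mu(X^n)$ satisfies a large deviations principle on $\mathbb R$ with speed $n$; denote its rate function by $\Lambda^*_\mu:\mathbb R\to[0,\infty]$. Then for every $g$ with $0<g<\log|\mathcal X|$, $$\log|\mathcal X|-g=\Lambda^*_u(g)>\frac1\eta\,\Lambda^*_\theta(\eta g).$$ -/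

import Mathlib

open MeasureTheory Filter Topology

namespace Guesswork

noncomputable section

/-- The sequence of Borel measures `μ n` on the real line satisfies a large deviations principle
with speed `n` and rate function `I` (lower semicontinuous, with values in `[0, ∞]`). -/
structure SatisfiesLDP (μ : ℕ → Measure ℝ) (I : ℝ → EReal) : Prop where
  nonneg : ∀ x, 0 ≤ I x
  lowerSemicontinuous : LowerSemicontinuous I
  lower_bound : ∀ U : Set ℝ, IsOpen U →
    -(⨅ x ∈ U, I x) ≤ liminf (fun n : ℕ => (((n : ℝ)⁻¹ : ℝ) : EReal) * ENNReal.log (μ n U)) atTop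
  upper_bound : ∀ F : Set ℝ, IsClosed F →
    limsup (fun n : ℕ => (((n : ℝ)⁻¹ : ℝ) : EReal) * ENNReal.log (μ n F)) atTop ≤ -(⨅ x ∈ F, I x)

/-- A sequence of measures has at most one rate function. -/
theorem SatisfiesLDP.unique {μ : ℕ → Measure ℝ} {I J : ℝ → EReal}
    (hI : SatisfiesLDP μ I) (hJ : SatisfiesLDP μ J) : I = J := by
  have key : ∀ {I J : ℝ → EReal}, SatisfiesLDP μ I → SatisfiesLDP μ J → ∀ x, I x ≤ J x := by
    intro I J hI hJ x
    by_contra! hlt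
    obtain ⟨c, hc1, hc2⟩ := exists_between hlt
    have hn : {y | c < I y} ∈ 𝓝 x := hI.lowerSemicontinuous x c hc2
    obtain ⟨F, hF, hFc, hFs⟩ := exists_mem_nhds_isClosed_subset hn
    have h1 : -(⨅ y ∈ interior F, J y) ≤ -(⨅ y ∈ F, I y) := by
      refine (hJ.lower_bound _ isOpen_interior).trans (le_trans ?_ (hI.upper_bound F hFc))
      refine le_trans (liminf_le_liminf (Eventually.of_forall fun n => ?_)) liminf_le_limsup
      have h0 : (0 : EReal) ≤ (((n : ℝ)⁻¹ : ℝ) : EReal) := by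
        exact_mod_cast (by positivity : (0 : ℝ) ≤ (n : ℝ)⁻¹)
      exact mul_le_mul_of_nonneg_left
        (ENNReal.log_monotone (measure_mono interior_subset)) h0
    have h2 : (⨅ y ∈ F, I y) ≤ ⨅ y ∈ interior F, J y := EReal.neg_le_neg_iff.mp h1
    have h3 : c ≤ ⨅ y ∈ F, I y := le_iInf₂ fun y hy => le_of_lt (hFs hy)
    have h4 : (⨅ y ∈ interior F, J y) ≤ J x := iInf₂_le x (mem_interior_iff_mem_nhds.mpr hF)
    exact absurd (h3.trans (h2.trans h4)) (not_le.mpr hc1)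
  exact funext fun x => le_antisymm (key hI hJ x) (key hJ hI x)

/-- The large deviations rate function of a sequence of measures
(the unique one if it exists, an arbitrary function otherwise). -/
def rateFunction (μ : ℕ → Measure ℝ) : ℝ → EReal :=
  Classical.epsilon (SatisfiesLDP μ)

variable {X : Type*} [Fintype X]

/-- The Shannon entropy (natural logarithm) of the letter distribution `θ`. -/
def entropy (θ : X → ℝ) : ℝ := ∑ x, θ x * Real.log (1 / θ x)

/-- The uniform source. -/
def uniformSource (X : Type*) [Fintype X] : X → ℝ := fun _ => 1 / (Fintype.card X : ℝ)

/-- The probability of the string `s` when its letters are i.i.d. with distribution `θ`. -/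
def stringProb (θ : X → ℝ) {n : ℕ} (s : Fin n → X) : ℝ := ∏ i, θ (s i)

/-- `G n s` is the number of guesses needed to find the string `s` of length `n` under a strategy
that queries all strings one by one in order of decreasing probability (ties broken
arbitrarily). -/
structure IsOptimalGuesswork (θ : X → ℝ) (G : (n : ℕ) → (Fin n → X) → ℕ) : Prop where
  bijOn : ∀ n, Set.BijOn (G n) Set.univ (Set.Icc 1 (Fintype.card X ^ n))
  decreasing : ∀ n (s t : Fin n → X), stringProb θ t < stringProb θ s → G n s < G n t

/-- The law of `n⁻¹ log (G n Xⁿ)`, where `Xⁿ` is a string of `n` i.i.d. letters with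
distribution `θ`. -/
def guessworkLaw (θ : X → ℝ) (G : (n : ℕ) → (Fin n → X) → ℕ) (n : ℕ) : Measure ℝ :=
  ∑ s : Fin n → X,
    ENNReal.ofReal (stringProb θ s) • Measure.dirac (Real.log (G n s : ℝ) / (n : ℝ))

/-- Optimal guessing strategies exist for every `θ`. -/
theorem exists_isOptimalGuesswork (θ : X → ℝ) : ∃ G, IsOptimalGuesswork θ G := by
  classical
  have h : ∀ n : ℕ, ∃ g : (Fin n → X) → ℕ,
      Set.BijOn g Set.univ (Set.Icc 1 (Fintype.card X ^ n)) ∧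
      ∀ s t : Fin n → X, stringProb θ t < stringProb θ s → g s < g t := by
    intro n
    have hc : Fintype.card (Fin n → X) = Fintype.card X ^ n := by simp
    let e : (Fin n → X) ≃ Fin (Fintype.card X ^ n) := Fintype.equivFinOfCardEq hc
    let f : Fin (Fintype.card X ^ n) → ℝ := fun k => -stringProb θ (e.symm k)
    let r : (Fin n → X) ≃ Fin (Fintype.card X ^ n) := e.trans (Tuple.sort f).symm
    refine ⟨fun s => (r s : ℕ) + 1, ⟨?_, ?_, ?_⟩, ?_⟩
    · intro s _
      have := (r s).isLt
      exact ⟨Nat.succ_le_succ (Nat.zero_le _), this⟩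
    · intro s _ t _ hst
      exact r.injective (Fin.ext (by simpa using hst))
    · rintro k ⟨h1, h2⟩
      refine ⟨r.symm ⟨k - 1, by omega⟩, trivial, ?_⟩
      simp only [Equiv.apply_symm_apply]
      omega
    · intro s t hst
      by_contra! hle
      have hrle : r t ≤ r s := by
        have : (r t : ℕ) ≤ (r s : ℕ) := by omega
        exact this
      have hm := Tuple.monotone_sort f hrle
      simp only [Function.comp, f, r, Equiv.trans_apply, Equiv.apply_symm_apply,
        Equiv.symm_apply_apply] at hm
      linarith
  choose g hg using h
  exact ⟨g, fun n => (hg n).1, fun n => (hg n).2⟩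

end

end Guesswork

/-! Write φ(α) = log ∑ θ_x^α (`logPowerSum`). The rate function is identified as `guessworkRate`: on
x ≥ 0 the supremum over α > 0 of (1/α - 1)x - φ(α)/α. By `guessworkRate_le_coe_iff` it is at most r
at x iff x ≤ φ(α) + α(x + r) for all α > 0. On the exponential scale this says that at least e^{nx}
strings have probability at least e^{-n(x+r)}.

Upper bound (`guessworkLaw_Icc_le`): about e^{nb} strings have guesswork exponent near b, and
`mul_stringProb_rpow_le` bounds the probability of each. Lower bound (`eventually_le_guessworkLaw`):
exponential tilting produces enough likely strings (`eventually_card_ge`), and optimal guessing puts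
likely strings early.

For the uniform source the rate is log|X| - g. Put H = H(θ) and x = ηg, so 0 < x < H. The claim
becomes: the rate of θ at x is strictly below H - x. Equivalently, x ≤ φ(α) + αc holds for all α > 0
with some c < H (`exists_guessworkRate_le`). For bounded α this follows from the tangent φ(α) ≥ (1 -
α)H at α = 1; for large α, from a letter z with -log θ_z < H, which exists because θ is not uniform.
-/

namespace Guesswork

noncomputable section

/-! ### Power sums, exponential tilting and counting likely strings. -/

section PowerSum

/-- The logarithm of the power sum `∑ x, θ x ^ α`. -/
def logPowerSum {X : Type*} [Fintype X] (θ : X → ℝ) (α : ℝ) : ℝ := Real.log (∑ x, θ x ^ α)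

variable {X : Type*} {θ : X → ℝ}

theorem stringProb_pos (hpos : ∀ x, 0 < θ x) {n : ℕ} (s : Fin n → X) : 0 < stringProb θ s :=
  Finset.prod_pos fun i _ => hpos (s i)

variable [Fintype X]

theorem logPowerSum_zero (θ : X → ℝ) : logPowerSum θ 0 = Real.log (Fintype.card X) := by
  simp [logPowerSum]

theorem logPowerSum_one (hsum : ∑ x, θ x = 1) : logPowerSum θ 1 = 0 := by
  simp [logPowerSum, hsum]

theorem mul_log_le_logPowerSum (hpos : ∀ x, 0 < θ x) (x : X) (α : ℝ) :
    α * Real.log (θ x) ≤ logPowerSum θ α := by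
  rw [← Real.log_rpow (hpos x)]
  exact Real.log_le_log (Real.rpow_pos_of_pos (hpos x) α) (Finset.single_le_sum
    (f := fun x => θ x ^ α) (fun z _ => Real.rpow_nonneg (hpos z).le α) (Finset.mem_univ x))

variable [Nonempty X]

theorem powerSum_pos (hpos : ∀ x, 0 < θ x) (α : ℝ) : 0 < ∑ x, θ x ^ α :=
  Finset.sum_pos (fun x _ => Real.rpow_pos_of_pos (hpos x) α) Finset.univ_nonempty

theorem sum_stringProb_rpow (hpos : ∀ x, 0 < θ x) (n : ℕ) (α : ℝ) :
    ∑ s : Fin n → X, stringProb θ s ^ α = Real.exp (n * logPowerSum θ α) := by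
  rw [logPowerSum, Real.exp_nat_mul, Real.exp_log (powerSum_pos hpos α), Fintype.sum_pow]
  refine Finset.sum_congr rfl fun s _ => ?_
  exact (Real.finsetProd_rpow _ _ (fun i _ => (hpos (s i)).le) α).symm

theorem differentiable_logPowerSum (hpos : ∀ x, 0 < θ x) : Differentiable ℝ (logPowerSum θ) := by
  intro α
  refine DifferentiableAt.log ?_ (powerSum_pos hpos α).ne'
  refine DifferentiableAt.fun_sum fun x _ => ?_
  exact (Real.hasStrictDerivAt_const_rpow (hpos x) α).hasDerivAt.differentiableAt

/-- Exponential Chebyshev bound for the tilted weights `stringProb θ s ^ α`. -/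
theorem sum_filter_stringProb_rpow_le (hpos : ∀ x, 0 < θ x) (n : ℕ) (α β m : ℝ) :
    ∑ s : Fin n → X with Real.exp (n * (β * m)) ≤ stringProb θ s ^ β, stringProb θ s ^ α ≤
      Real.exp (n * (logPowerSum θ (α + β) - β * m)) := by
  rw [mul_sub, Real.exp_sub, ← sum_stringProb_rpow hpos, le_div_iff₀ (Real.exp_pos _),
    Finset.sum_mul]
  refine (Finset.sum_le_sum fun s hs => ?_).trans (Finset.sum_le_sum_of_subset_of_nonneg
    (Finset.filter_subset _ _) fun s _ _ => Real.rpow_nonneg (stringProb_pos hpos s).le _)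
  rw [Real.rpow_add (stringProb_pos hpos s)]
  exact mul_le_mul_of_nonneg_left (Finset.mem_filter.mp hs).2
    (Real.rpow_nonneg (stringProb_pos hpos s).le _)

theorem eventually_exp_mul_le {a b C : ℝ} (hab : a < b) (hC : 0 < C) :
    ∀ᶠ n : ℕ in atTop, Real.exp (n * a) ≤ C * Real.exp (n * b) := by
  have h : Tendsto (fun n : ℕ => Real.exp (n * (a - b))) atTop (𝓝 0) :=
    Real.tendsto_exp_atBot.comp
      (tendsto_natCast_atTop_atTop.atTop_mul_const_of_neg (sub_neg.mpr hab))
  filter_upwards [h.eventually_lt_const hC] with n hn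
  have : Real.exp (n * a) = Real.exp (n * (a - b)) * Real.exp (n * b) := by
    rw [← Real.exp_add]; ring_nf
  rw [this]
  exact mul_le_mul_of_nonneg_right hn.le (Real.exp_pos _).le

/-- Since d is the slope of φ at α, a small β > 0 satisfies φ(α + β) - β(d + γ) < φ(α), so the
Chebyshev bound is exponentially smaller than the total weight. The lower tail is the same with β <
0. -/
theorem eventually_upper_tail_le (hpos : ∀ x, 0 < θ x) {α d γ : ℝ}
    (hd : HasDerivAt (logPowerSum θ) d α) (hγ : 0 < γ) :
    ∀ᶠ n : ℕ in atTop,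
      ∑ s : Fin n → X with Real.exp (n * (d + γ)) ≤ stringProb θ s, stringProb θ s ^ α ≤
        1 / 4 * Real.exp (n * logPowerSum θ α) := by
  have h1 := hd.tendsto_slope_zero_right.eventually_lt_const (show d < d + γ by linarith)
  obtain ⟨β, hβ, hβ0⟩ := (h1.and self_mem_nhdsWithin).exists
  replace hβ0 : 0 < β := hβ0
  rw [smul_eq_mul, inv_mul_lt_iff₀ hβ0] at hβ
  filter_upwards [eventually_exp_mul_le (C := 1 / 4) (show logPowerSum θ (α + β) - β * (d + γ) <
    logPowerSum θ α by linarith) (by norm_num)] with n hn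
  refine le_trans ?_ hn
  refine le_trans (Finset.sum_le_sum_of_subset_of_nonneg ?_ fun s _ _ =>
    Real.rpow_nonneg (stringProb_pos hpos s).le _)
    (sum_filter_stringProb_rpow_le hpos n α β (d + γ))
  refine Finset.monotone_filter_right _ fun s _ hs => ?_
  have := Real.rpow_le_rpow (Real.exp_pos _).le hs hβ0.le
  rw [← Real.exp_mul] at this
  convert this using 2
  ring

theorem eventually_lower_tail_le (hpos : ∀ x, 0 < θ x) {α d γ : ℝ}
    (hd : HasDerivAt (logPowerSum θ) d α) (hγ : 0 < γ) :
    ∀ᶠ n : ℕ in atTop,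
      ∑ s : Fin n → X with stringProb θ s ≤ Real.exp (n * (d - γ)), stringProb θ s ^ α ≤
        1 / 4 * Real.exp (n * logPowerSum θ α) := by
  have h1 := hd.tendsto_slope_zero_left.eventually_const_lt (show d - γ < d by linarith)
  obtain ⟨β, hβ, hβ0⟩ := (h1.and self_mem_nhdsWithin).exists
  replace hβ0 : β < 0 := hβ0
  rw [smul_eq_mul, inv_mul_eq_div, lt_div_iff_of_neg hβ0] at hβ
  filter_upwards [eventually_exp_mul_le (C := 1 / 4) (show logPowerSum θ (α + β) - β * (d - γ) <
    logPowerSum θ α by linarith) (by norm_num)] with n hn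
  refine le_trans ?_ hn
  refine le_trans (Finset.sum_le_sum_of_subset_of_nonneg ?_ fun s _ _ =>
    Real.rpow_nonneg (stringProb_pos hpos s).le _)
    (sum_filter_stringProb_rpow_le hpos n α β (d - γ))
  refine Finset.monotone_filter_right _ fun s _ hs => ?_
  have := Real.rpow_le_rpow_of_nonpos (stringProb_pos hpos s) hs hβ0.le
  rw [← Real.exp_mul] at this
  convert this using 2
  ring

/-- Most of the tilted weight sits on strings of typical probability. -/
theorem eventually_typical_ge (hpos : ∀ x, 0 < θ x) {α d γ : ℝ}
    (hd : HasDerivAt (logPowerSum θ) d α) (hγ : 0 < γ) :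
    ∀ᶠ n : ℕ in atTop,
      1 / 2 * Real.exp (n * logPowerSum θ α) ≤
      ∑ s : Fin n → X with Real.exp (n * (d - γ)) < stringProb θ s ∧
        stringProb θ s < Real.exp (n * (d + γ)), stringProb θ s ^ α := by
  filter_upwards [eventually_upper_tail_le hpos hd hγ, eventually_lower_tail_le hpos hd hγ]
    with n h1 h2
  have h3 := sum_stringProb_rpow hpos n α
  rw [Finset.sum_filter] at h1 h2 ⊢
  have h4 : ∑ s : Fin n → X, stringProb θ s ^ α ≤
      (∑ s : Fin n → X, if Real.exp (n * (d + γ)) ≤ stringProb θ s then stringProb θ s ^ α else 0)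
      + (∑ s : Fin n → X, if stringProb θ s ≤ Real.exp (n * (d - γ)) then stringProb θ s ^ α else 0)
      + ∑ s : Fin n → X, if Real.exp (n * (d - γ)) < stringProb θ s ∧
        stringProb θ s < Real.exp (n * (d + γ)) then stringProb θ s ^ α else 0 := by
    rw [← Finset.sum_add_distrib, ← Finset.sum_add_distrib]
    refine Finset.sum_le_sum fun s _ => ?_
    have := Real.rpow_nonneg (stringProb_pos hpos s).le α
    by_cases ha : Real.exp (n * (d + γ)) ≤ stringProb θ s
    · rw [if_pos ha]
      split_ifs <;> linarith
    · by_cases hb : stringProb θ s ≤ Real.exp (n * (d - γ))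
      · rw [if_neg ha, if_pos hb]
        split_ifs <;> linarith
      · rw [if_neg ha, if_neg hb, if_pos ⟨not_le.mp hb, not_le.mp ha⟩]
        linarith
  linarith

/-- A minimiser of `logPowerSum θ α + α * L` over the half-line. -/
theorem exists_minimiser (hpos : ∀ x, 0 < θ x) {y L δ : ℝ} (hδ : 0 < δ)
    (hy : y < Real.log (Fintype.card X))
    (h : ∀ α, 0 < α → y ≤ logPowerSum θ α + α * (L - δ)) :
    ∃ α d, 0 ≤ α ∧ HasDerivAt (logPowerSum θ) d α ∧ y < logPowerSum θ α + α * L ∧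
      0 ≤ d + L ∧ α * (d + L) = 0 := by
  set f : ℝ → ℝ := fun α => logPowerSum θ α + α * L with hf
  have hdf : Differentiable ℝ f :=
    (differentiable_logPowerSum hpos).add (differentiable_id.mul_const L)
  have hf0 : f 0 = Real.log (Fintype.card X) := by simp [hf, logPowerSum_zero]
  -- At R the lower bound y + R * δ equals f 0 + 1, so the minimum over [0, R] is not attained at
  -- the right end. It may be at 0, where only the one-sided condition on the derivative survives.
  set R := (Real.log (Fintype.card X) - y + 1) / δ with hR
  have hR0 : 0 < R := div_pos (by linarith) hδ
  obtain ⟨α, hα, hmin⟩ := isCompact_Icc.exists_isMinOn (Set.nonempty_Icc.mpr hR0.le)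
    hdf.continuous.continuousOn
  have hge : ∀ a, 0 < a → y + a * δ ≤ f a := fun a ha => by
    have := h a ha
    simp only [hf]; linarith
  have hfα0 : f α ≤ f 0 := hmin (Set.left_mem_Icc.mpr hR0.le)
  have hαR : α < R := by
    refine lt_of_le_of_ne hα.2 ?_
    rintro rfl
    have h1 := hge _ hR0
    rw [div_mul_cancel₀ _ hδ.ne'] at h1
    linarith
  have hd := (differentiable_logPowerSum hpos α).hasDerivAt
  have hdα : HasDerivAt f (deriv (logPowerSum θ) α + L) α := by
    simpa only [one_mul] using hd.fun_add ((hasDerivAt_id' α).mul_const L)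
  refine ⟨α, _, hα.1, hd, ?_, ?_, ?_⟩
  · rcases hα.1.eq_or_lt with h0 | h0
    · rwa [← h0, logPowerSum_zero, zero_mul, add_zero]
    · have := hge α h0
      have := mul_pos h0 hδ
      change y < f α
      linarith
  · refine ge_of_tendsto hdα.tendsto_slope_zero_right ?_
    filter_upwards [Ioo_mem_nhdsGT (show (0 : ℝ) < R - α by linarith)] with t ht
    have : f α ≤ f (α + t) := hmin ⟨by linarith [hα.1, ht.1], by linarith [ht.2]⟩
    rw [smul_eq_mul]
    exact mul_nonneg (inv_nonneg.mpr ht.1.le) (by linarith)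
  · rcases hα.1.eq_or_lt with h0 | h0
    · rw [← h0, zero_mul]
    · rw [(hmin.isLocalMin (Icc_mem_nhds h0 hαR)).hasDerivAt_eq_zero hdα, mul_zero]

/-- Cramér-type lower bound for the number of strings of large probability. -/
theorem eventually_card_ge (hpos : ∀ x, 0 < θ x) {y L δ : ℝ} (hδ : 0 < δ)
    (hy : y < Real.log (Fintype.card X))
    (h : ∀ α, 0 < α → y ≤ logPowerSum θ α + α * (L - δ)) :
    ∀ᶠ n : ℕ in atTop, Real.exp (n * y) ≤
      (Finset.card {s : Fin n → X | Real.exp (-(n * L)) ≤ stringProb θ s} : ℝ) := by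
  -- Half of δ is kept in reserve: d + L ≥ δ / 2 leaves room for the typicality window γ.
  obtain ⟨α, d, hα, hd, hyα, hdL, hα0⟩ := exists_minimiser hpos (half_pos hδ) hy
    (L := L - δ / 2) (fun a ha => (h a ha).trans_eq (by ring))
  set η := logPowerSum θ α + α * (L - δ / 2) - y with hη
  obtain ⟨γ, hγ, hγδ, hγη⟩ : ∃ γ, 0 < γ ∧ γ ≤ δ / 2 ∧ α * γ < η := by
    have hη0 : 0 < η := by linarith
    have hα1 : 0 < α + 1 := by linarith
    refine ⟨min (δ / 2) (η / (α + 1)), lt_min (half_pos hδ) (div_pos hη0 hα1), min_le_left _ _, ?_⟩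
    calc α * min (δ / 2) (η / (α + 1)) ≤ α * (η / (α + 1)) :=
          mul_le_mul_of_nonneg_left (min_le_right _ _) hα
      _ < (α + 1) * (η / (α + 1)) := by
          have := div_pos hη0 hα1
          linarith
      _ = η := mul_div_cancel₀ _ hα1.ne'
  -- By complementary slackness `hα0`, α * d = -α * (L - δ / 2), so φ(α) - α * d is the minimum,
  -- which exceeds y by `η`.
  have hlt : y + α * (d + γ) < logPowerSum θ α := by linarith
  filter_upwards [eventually_typical_ge hpos hd hγ,
    eventually_exp_mul_le (C := 1 / 2) hlt (by norm_num)] with n hn hn2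
  set A : Finset (Fin n → X) := {s | Real.exp (-(n * L)) ≤ stringProb θ s}
  have hA : ∑ s : Fin n → X with Real.exp (n * (d - γ)) < stringProb θ s ∧
        stringProb θ s < Real.exp (n * (d + γ)), stringProb θ s ^ α ≤
        A.card * Real.exp (n * (α * (d + γ))) := by
    refine (Finset.sum_le_card_nsmul _ _ (Real.exp (n * (α * (d + γ)))) ?_).trans ?_
    · intro s hs
      have h1 := Real.rpow_le_rpow (stringProb_pos hpos s).le (Finset.mem_filter.mp hs).2.2.le hα
      rwa [← Real.exp_mul, show n * (d + γ) * α = n * (α * (d + γ)) by ring] at h1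
    · rw [nsmul_eq_mul]
      refine mul_le_mul_of_nonneg_right (Nat.cast_le.mpr (Finset.card_le_card ?_))
        (Real.exp_pos _).le
      refine Finset.monotone_filter_right _ fun s _ hs => ?_
      refine le_trans (Real.exp_le_exp.mpr ?_) hs.1.le
      have : (n : ℝ) * (-L) ≤ n * (d - γ) :=
        mul_le_mul_of_nonneg_left (by linarith) (Nat.cast_nonneg n)
      linarith
  have hfin := hn2.trans (hn.trans hA)
  rw [mul_add, Real.exp_add] at hfin
  exact le_of_mul_le_mul_right hfin (Real.exp_pos _)

end PowerSum

/-! ### Finite-n bounds for the law of guesswork. -/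

section Law

variable {X : Type*} [Fintype X] {θ : X → ℝ} {G : (n : ℕ) → (Fin n → X) → ℕ}

theorem guessworkLaw_apply (hpos : ∀ x, 0 < θ x) (n : ℕ) {S : Set ℝ} [DecidablePred (· ∈ S)]
    (hS : MeasurableSet S) :
    guessworkLaw θ G n S =
      ENNReal.ofReal (∑ s : Fin n → X with Real.log (G n s) / n ∈ S, stringProb θ s) := by
  rw [ENNReal.ofReal_sum_of_nonneg fun s _ => (stringProb_pos hpos s).le, guessworkLaw,
    Measure.finsetSum_apply, Finset.sum_filter]
  refine Finset.sum_congr rfl fun s _ => ?_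
  rw [Measure.smul_apply, Measure.dirac_apply' _ hS, Set.indicator_apply]
  split_ifs <;> simp

namespace IsOptimalGuesswork

variable (hG : IsOptimalGuesswork θ G)
include hG

theorem one_le (n : ℕ) (s : Fin n → X) : 1 ≤ G n s :=
  ((hG.bijOn n).mapsTo (Set.mem_univ s)).1

theorem le_card_pow (n : ℕ) (s : Fin n → X) : G n s ≤ Fintype.card X ^ n :=
  ((hG.bijOn n).mapsTo (Set.mem_univ s)).2

theorem card_filter_mem (n : ℕ) {B : Finset ℕ} (hB : B ⊆ Finset.Icc 1 (Fintype.card X ^ n)) :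
    Finset.card {s : Fin n → X | G n s ∈ B} = B.card := by
  refine Finset.card_nbij (G n) (fun s hs => (Finset.mem_filter.mp hs).2)
    ((hG.bijOn n).injOn.mono (Set.subset_univ _)) ?_
  intro k hk
  obtain ⟨s, -, hs⟩ := (hG.bijOn n).surjOn (Finset.mem_Icc.mp (hB hk))
  exact ⟨s, by simpa [hs] using hk, hs⟩

theorem stringProb_le_of_le {n : ℕ} {s t : Fin n → X} (h : G n s ≤ G n t) :
    stringProb θ t ≤ stringProb θ s :=
  not_lt.mp fun hlt => (hG.decreasing n t s hlt).not_ge h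

/-- Strings guessed within the number of strings of probability at least `p` have probability at
least `p`. -/
theorem le_stringProb {n : ℕ} {s : Fin n → X} {p : ℝ}
    (h : G n s ≤ Finset.card {t : Fin n → X | p ≤ stringProb θ t}) : p ≤ stringProb θ s := by
  by_contra! hlt
  have hsub : Finset.image (G n) {t : Fin n → X | p ≤ stringProb θ t} ⊆
      Finset.Ico 1 (G n s) := by
    intro k hk
    obtain ⟨t, ht, rfl⟩ := Finset.mem_image.mp hk
    exact Finset.mem_Ico.mpr ⟨hG.one_le n t,
      hG.decreasing n t s (hlt.trans_le (Finset.mem_filter.mp ht).2)⟩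
  have hc := Finset.card_le_card hsub
  rw [Finset.card_image_of_injOn ((hG.bijOn n).injOn.mono (Set.subset_univ _)),
    Nat.card_Ico] at hc
  have := hG.one_le n s
  omega

/-- A Markov-type bound: the `G n s` strings queried up to and including `s` are all at least as
probable as `s`. -/
theorem mul_stringProb_rpow_le (hpos : ∀ x, 0 < θ x) [Nonempty X] (n : ℕ) (s : Fin n → X)
    {α : ℝ} (hα : 0 ≤ α) :
    G n s * stringProb θ s ^ α ≤ Real.exp (n * logPowerSum θ α) := by
  rw [← sum_stringProb_rpow hpos]
  have hcard := hG.card_filter_mem n (Finset.Icc_subset_Icc_right (a := 1) (hG.le_card_pow n s))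
  rw [Nat.card_Icc, Nat.add_sub_cancel] at hcard
  calc (G n s : ℝ) * stringProb θ s ^ α
      = ∑ t : Fin n → X with G n t ∈ Finset.Icc 1 (G n s), stringProb θ s ^ α := by
        rw [Finset.sum_const, hcard, nsmul_eq_mul]
    _ ≤ ∑ t : Fin n → X with G n t ∈ Finset.Icc 1 (G n s), stringProb θ t ^ α :=
        Finset.sum_le_sum fun t ht => Real.rpow_le_rpow (stringProb_pos hpos s).le
          (hG.stringProb_le_of_le (Finset.mem_Icc.mp (Finset.mem_filter.mp ht).2).2) hα
    _ ≤ ∑ t : Fin n → X, stringProb θ t ^ α :=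
        Finset.sum_le_sum_of_subset_of_nonneg (Finset.filter_subset _ _)
          fun t _ _ => Real.rpow_nonneg (stringProb_pos hpos t).le α

theorem log_div_mem (n : ℕ) (s : Fin n → X) :
    Real.log (G n s) / n ∈ Set.Icc 0 (Real.log (Fintype.card X)) := by
  have h1 : (1 : ℝ) ≤ G n s := Nat.one_le_cast.mpr (hG.one_le n s)
  refine ⟨div_nonneg (Real.log_nonneg h1) (Nat.cast_nonneg n), ?_⟩
  refine div_le_of_le_mul₀ (Nat.cast_nonneg n) (Real.log_natCast_nonneg _) ?_
  rw [mul_comm, ← Real.log_pow]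
  exact Real.log_le_log (by linarith) (by exact_mod_cast hG.le_card_pow n s)

/-- Count times size: the upper endpoint limits how many strings qualify, and the lower endpoint
limits the probability of each through `mul_stringProb_rpow_le`. -/
theorem guessworkLaw_Icc_le (hpos : ∀ x, 0 < θ x) [Nonempty X] {a b α : ℝ} (hα : 0 < α)
    {n : ℕ} (hn : n ≠ 0) :
    guessworkLaw θ G n (Set.Icc a b) ≤
      ENNReal.ofReal (Real.exp (n * (b + (logPowerSum θ α - a) / α))) := by
  classical
  have hn0 : (0 : ℝ) < n := by positivity
  rw [guessworkLaw_apply hpos n measurableSet_Icc]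
  refine ENNReal.ofReal_le_ofReal ?_
  have hG0 : ∀ s, (0 : ℝ) < G n s := fun s => Nat.cast_pos.mpr (hG.one_le n s)
  have hprob : ∀ s : Fin n → X, Real.log (G n s) / n ∈ Set.Icc a b →
      stringProb θ s ≤ Real.exp (n * ((logPowerSum θ α - a) / α)) := by
    intro s hs
    have h1 := Real.log_le_log (mul_pos (hG0 s) (Real.rpow_pos_of_pos (stringProb_pos hpos s) α))
      (hG.mul_stringProb_rpow_le hpos n s hα.le)
    rw [Real.log_mul (hG0 s).ne' (Real.rpow_pos_of_pos (stringProb_pos hpos s) α).ne',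
      Real.log_rpow (stringProb_pos hpos s), Real.log_exp] at h1
    have h2 := (le_div_iff₀ hn0).mp hs.1
    rw [← Real.log_le_iff_le_exp (stringProb_pos hpos s), ← mul_div_assoc, le_div_iff₀ hα]
    linarith
  have hcard : (Finset.card {s : Fin n → X | Real.log (G n s) / n ∈ Set.Icc a b} : ℝ) ≤
      Real.exp (n * b) := by
    refine le_trans (Nat.cast_le.mpr ?_) (Nat.floor_le (Real.exp_pos _).le)
    have hsub : Finset.image (G n) {s : Fin n → X | Real.log (G n s) / n ∈ Set.Icc a b} ⊆
        Finset.Icc 1 ⌊Real.exp (n * b)⌋₊ := by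
      intro k hk
      obtain ⟨s, hs, rfl⟩ := Finset.mem_image.mp hk
      refine Finset.mem_Icc.mpr ⟨hG.one_le n s, Nat.le_floor ?_⟩
      rw [← Real.log_le_iff_le_exp (hG0 s), mul_comm]
      exact (div_le_iff₀ hn0).mp (Finset.mem_filter.mp hs).2.2
    have hc := Finset.card_le_card hsub
    rwa [Finset.card_image_of_injOn ((hG.bijOn n).injOn.mono (Set.subset_univ _)),
      Nat.card_Icc, Nat.add_sub_cancel] at hc
  refine (Finset.sum_le_card_nsmul _ _ _ fun s hs => hprob s (Finset.mem_filter.mp hs).2).trans ?_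
  rw [nsmul_eq_mul, mul_add, Real.exp_add]
  exact mul_le_mul_of_nonneg_right hcard (Real.exp_pos _).le

theorem eventually_le_guessworkLaw (hpos : ∀ x, 0 < θ x) [Nonempty X] {U : Set ℝ}
    (hU : MeasurableSet U) {y ε L δ : ℝ} (hy0 : 0 < y) (hy : y < Real.log (Fintype.card X))
    (hε : 0 < ε) (hyU : Set.Ioc (y - ε) y ⊆ U) (hδ : 0 < δ)
    (h : ∀ α, 0 < α → y ≤ logPowerSum θ α + α * (L - δ)) :
    ∀ᶠ n : ℕ in atTop,
      ENNReal.ofReal (1 / 2 * Real.exp (n * (y - L))) ≤ guessworkLaw θ G n U := by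
  classical
  filter_upwards [eventually_card_ge hpos hδ hy h, eventually_ne_atTop 0,
    eventually_exp_mul_le (C := 1 / 4) (show y - ε < y by linarith) (by norm_num),
    eventually_exp_mul_le (C := 1 / 4) hy0 (by norm_num)] with n hcard hn hn1 hn2
  have hn0 : (0 : ℝ) < n := by positivity
  rw [mul_zero, Real.exp_zero] at hn2
  rw [guessworkLaw_apply hpos n hU]
  refine ENNReal.ofReal_le_ofReal ?_
  -- These ranks have exponents in (y - ε, y], and none exceeds the number of strings of probability
  -- at least e^{-nL}. The two conditions with constant 1/4 absorb the lower ranks and the rounding.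
  set B := Finset.Ioc ⌊Real.exp (n * (y - ε))⌋₊ ⌊Real.exp (n * y)⌋₊ with hB
  have hBsub : B ⊆ Finset.Icc 1 (Fintype.card X ^ n) := by
    intro k hk
    have hk := Finset.mem_Ioc.mp hk
    refine Finset.mem_Icc.mpr ⟨Nat.one_le_iff_ne_zero.mpr (by omega), hk.2.trans ?_⟩
    refine Nat.floor_le_of_le ?_
    push_cast
    rw [← Real.exp_log (show (0 : ℝ) < Fintype.card X by exact_mod_cast Fintype.card_pos),
      ← Real.exp_nat_mul]
    exact Real.exp_le_exp.mpr (mul_le_mul_of_nonneg_left hy.le hn0.le)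
  have hBcard : 1 / 2 * Real.exp (n * y) ≤ (B.card : ℝ) := by
    have h1 := Nat.floor_le (Real.exp_pos (n * (y - ε))).le
    have h2 := Nat.lt_floor_add_one (Real.exp (n * y))
    have h3 : (⌊Real.exp (n * y)⌋₊ : ℝ) - ⌊Real.exp (n * (y - ε))⌋₊ ≤ (B.card : ℝ) := by
      rw [hB, Nat.card_Ioc, sub_le_iff_le_add]
      exact_mod_cast Nat.sub_le_iff_le_add.mp le_rfl
    linarith
  have hprob : ∀ s : Fin n → X, G n s ∈ B → Real.exp (-(n * L)) ≤ stringProb θ s := by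
    intro s hs
    refine hG.le_stringProb ?_
    have h1 := (Nat.le_floor_iff (Real.exp_pos _).le).mp (Finset.mem_Ioc.mp hs).2
    exact_mod_cast h1.trans hcard
  have hmem : ∀ s : Fin n → X, G n s ∈ B → Real.log (G n s) / n ∈ U := by
    intro s hs
    have hs := Finset.mem_Ioc.mp hs
    have hG0 : (0 : ℝ) < G n s := Nat.cast_pos.mpr (hG.one_le n s)
    refine hyU ⟨?_, ?_⟩
    · rw [lt_div_iff₀ hn0, mul_comm, Real.lt_log_iff_exp_lt hG0]
      exact (Nat.floor_lt (Real.exp_pos _).le).mp hs.1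
    · rw [div_le_iff₀ hn0, mul_comm, Real.log_le_iff_le_exp hG0]
      exact (Nat.le_floor_iff (Real.exp_pos _).le).mp hs.2
  calc 1 / 2 * Real.exp (n * (y - L))
      = 1 / 2 * Real.exp (n * y) * Real.exp (-(n * L)) := by
        rw [mul_assoc, ← Real.exp_add]; ring_nf
    _ ≤ B.card * Real.exp (-(n * L)) := mul_le_mul_of_nonneg_right hBcard (Real.exp_pos _).le
    _ = ∑ s : Fin n → X with G n s ∈ B, Real.exp (-(n * L)) := by
        rw [Finset.sum_const, hG.card_filter_mem n hBsub, nsmul_eq_mul]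
    _ ≤ ∑ s : Fin n → X with G n s ∈ B, stringProb θ s :=
        Finset.sum_le_sum fun s hs => hprob s (Finset.mem_filter.mp hs).2
    _ ≤ _ := Finset.sum_le_sum_of_subset_of_nonneg
        (Finset.monotone_filter_right _ fun s _ hs => hmem s hs)
        fun s _ _ => (stringProb_pos hpos s).le

theorem pow_le_guessworkLaw (hpos : ∀ x, 0 < θ x) [Nonempty X] {U : Set ℝ}
    (hU : MeasurableSet U) (h0 : (0 : ℝ) ∈ U) (n : ℕ) (x : X) :
    ENNReal.ofReal (Real.exp (n * Real.log (θ x))) ≤ guessworkLaw θ G n U := by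
  classical
  rw [guessworkLaw_apply hpos n hU]
  refine ENNReal.ofReal_le_ofReal ?_
  obtain ⟨s, -, hs⟩ := (hG.bijOn n).surjOn
    (show 1 ∈ Set.Icc 1 (Fintype.card X ^ n) from ⟨le_rfl, Nat.one_le_pow _ _ Fintype.card_pos⟩)
  calc Real.exp (n * Real.log (θ x)) = stringProb θ fun _ : Fin n => x := by
        rw [Real.exp_nat_mul, Real.exp_log (hpos x)]; simp [stringProb]
    _ ≤ stringProb θ s := hG.stringProb_le_of_le (hs ▸ hG.one_le n _)
    _ ≤ _ := Finset.single_le_sum (f := stringProb θ) (fun t _ => (stringProb_pos hpos t).le)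
        (Finset.mem_filter.mpr ⟨Finset.mem_univ s, by simpa [hs] using h0⟩)

end IsOptimalGuesswork

end Law

/-! ### The rate function and the large deviations principle. -/

/-- The rate function of guesswork, as a Legendre-type transform of `logPowerSum`. -/
def guessworkRate {X : Type*} [Fintype X] (θ : X → ℝ) (x : ℝ) : EReal :=
  -- The supremum alone can be finite for x < 0, where guesswork has no mass. Above log|X| it is
  -- already infinite, by letting α → 0.
  if x < 0 then ⊤ else
    ⨆ α : Set.Ioi (0 : ℝ), (((1 / α - 1) * x - logPowerSum θ α / α : ℝ) : EReal)

variable {X : Type*} [Fintype X] {θ : X → ℝ} {G : (n : ℕ) → (Fin n → X) → ℕ}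

theorem guessworkRate_le_coe_iff {x r : ℝ} (hx : 0 ≤ x) :
    guessworkRate θ x ≤ r ↔ ∀ α, 0 < α → x ≤ logPowerSum θ α + α * (x + r) := by
  rw [guessworkRate, if_neg hx.not_gt, iSup_le_iff, Subtype.forall]
  refine forall₂_congr fun α hα => ?_
  replace hα : 0 < α := hα
  have h : (1 / α - 1) * x - logPowerSum θ α / α = (x - logPowerSum θ α) / α - x := by
    field_simp
    ring
  rw [EReal.coe_le_coe_iff, h, sub_le_iff_le_add, div_le_iff₀ hα]
  constructor <;> intro h <;> linarith

theorem coe_lt_guessworkRate_iff {x c : ℝ} (hx : 0 ≤ x) :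
    c < guessworkRate θ x ↔
      ∃ α, 0 < α ∧ c < (1 / α - 1) * x - logPowerSum θ α / α := by
  rw [guessworkRate, if_neg hx.not_gt, lt_iSup_iff, Subtype.exists]
  simp only [EReal.coe_lt_coe_iff, Set.mem_Ioi, exists_prop]

theorem guessworkRate_nonneg (hsum : ∑ x, θ x = 1) (x : ℝ) : 0 ≤ guessworkRate θ x := by
  rw [guessworkRate]
  split_ifs
  · exact le_top
  · refine le_iSup_of_le ⟨1, Set.mem_Ioi.mpr one_pos⟩ ?_
    simp [logPowerSum_one hsum]

theorem lowerSemicontinuous_guessworkRate (θ : X → ℝ) :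
    LowerSemicontinuous (guessworkRate θ) := by
  intro x c hc
  rcases lt_or_ge x 0 with hx | hx
  · filter_upwards [Iio_mem_nhds hx] with y hy
    rw [guessworkRate, if_pos hx] at hc
    rwa [guessworkRate, if_pos (show y < 0 from hy)]
  · rw [guessworkRate, if_neg hx.not_gt] at hc
    obtain ⟨α, hα⟩ := lt_iSup_iff.mp hc
    have hcont : Continuous fun y : ℝ =>
        (((1 / (α : ℝ) - 1) * y - logPowerSum θ α / α : ℝ) : EReal) :=
      continuous_coe_real_ereal.comp (by fun_prop)
    filter_upwards [hcont.continuousAt.eventually_const_lt hα] with y hy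
    rw [guessworkRate]
    split_ifs
    · exact hy.trans_le le_top
    · exact hy.trans_le (le_iSup (fun α : Set.Ioi (0 : ℝ) =>
        (((1 / (α : ℝ) - 1) * y - logPowerSum θ α / α : ℝ) : EReal)) α)

theorem le_inv_mul_log {n : ℕ} (hn : n ≠ 0) {c : ℝ} {m : ENNReal}
    (h : ENNReal.ofReal (Real.exp (n * c)) ≤ m) :
    (c : EReal) ≤ (((n : ℝ)⁻¹ : ℝ) : EReal) * ENNReal.log m := by
  have hn0 : (n : ℝ) ≠ 0 := by positivity
  calc (c : EReal) = (((n : ℝ)⁻¹ : ℝ) : EReal) * ENNReal.log (ENNReal.ofReal (Real.exp (n * c))) := by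
        rw [ENNReal.log_ofReal_of_pos (Real.exp_pos _), Real.log_exp, ← EReal.coe_mul,
          inv_mul_cancel_left₀ hn0]
    _ ≤ _ := mul_le_mul_of_nonneg_left (ENNReal.log_monotone h)
        (EReal.coe_nonneg.mpr (by positivity))

theorem inv_mul_log_le {n : ℕ} (hn : n ≠ 0) {c : ℝ} {m : ENNReal}
    (h : m ≤ ENNReal.ofReal (Real.exp (n * c))) :
    (((n : ℝ)⁻¹ : ℝ) : EReal) * ENNReal.log m ≤ c := by
  have hn0 : (n : ℝ) ≠ 0 := by positivity
  calc _ ≤ (((n : ℝ)⁻¹ : ℝ) : EReal) * ENNReal.log (ENNReal.ofReal (Real.exp (n * c))) :=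
        mul_le_mul_of_nonneg_left (ENNReal.log_monotone h) (EReal.coe_nonneg.mpr (by positivity))
    _ = (c : EReal) := by
        rw [ENNReal.log_ofReal_of_pos (Real.exp_pos _), Real.log_exp, ← EReal.coe_mul,
          inv_mul_cancel_left₀ hn0]

theorem exists_guessworkLaw_le (hpos : ∀ x, 0 < θ x) [Nonempty X] (hG : IsOptimalGuesswork θ G)
    {F : Set ℝ} (hF : IsClosed F) {c : ℝ} (hc : ∀ x ∈ F, (c : EReal) < guessworkRate θ x) :
    ∃ C : ℝ, 0 ≤ C ∧ ∀ n ≠ 0,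
      guessworkLaw θ G n F ≤ ENNReal.ofReal (C * Real.exp (n * (-c))) := by
  classical
  -- Guesswork exponents lie in [0, log|X|], so a closed set may be replaced by a compact one and
  -- covered by finitely many short intervals.
  set K := F ∩ Set.Icc 0 (Real.log (Fintype.card X)) with hK
  have hKc : IsCompact K := isCompact_Icc.inter_left hF
  have hKF : ∀ n, guessworkLaw θ G n F = guessworkLaw θ G n K := by
    intro n
    rw [guessworkLaw_apply hpos n hF.measurableSet, guessworkLaw_apply hpos n hKc.measurableSet]
    congr 2
    exact Finset.filter_congr fun s _ => (and_iff_left (hG.log_div_mem n s)).symm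
  simp only [hKF]
  refine hKc.induction_on (p := fun S => ∃ C : ℝ, 0 ≤ C ∧ ∀ n ≠ 0,
      guessworkLaw θ G n S ≤ ENNReal.ofReal (C * Real.exp (n * (-c)))) ?_ ?_ ?_ ?_
  · exact ⟨0, le_rfl, fun n _ => by simp⟩
  · rintro S T hST ⟨C, hC, h⟩
    exact ⟨C, hC, fun n hn => (measure_mono hST).trans (h n hn)⟩
  · rintro S T ⟨C, hC, h⟩ ⟨D, hD, h'⟩
    refine ⟨C + D, add_nonneg hC hD, fun n hn => (measure_union_le S T).trans ?_⟩
    rw [add_mul, ENNReal.ofReal_add (mul_nonneg hC (Real.exp_pos _).le)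
      (mul_nonneg hD (Real.exp_pos _).le)]
    exact add_le_add (h n hn) (h' n hn)
  · intro x hx
    obtain ⟨α, hα, hcα⟩ := (coe_lt_guessworkRate_iff hx.2.1).mp (hc x hx.1)
    -- Chosen so that the exponent from `guessworkLaw_Icc_le` on [x - ε, x + ε] is exactly -c.
    set ε := ((1 / α - 1) * x - logPowerSum θ α / α - c) / (1 + 1 / α) with hε
    have hα1 : 0 < 1 + 1 / α := by positivity
    have hε0 : 0 < ε := div_pos (by linarith) hα1
    refine ⟨Set.Icc (x - ε) (x + ε),
      mem_nhdsWithin_of_mem_nhds (Icc_mem_nhds (by linarith) (by linarith)), 1, zero_le_one,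
      fun n hn => (hG.guessworkLaw_Icc_le hpos hα hn).trans_eq ?_⟩
    have h1 : ε * (1 + 1 / α) = (1 / α - 1) * x - logPowerSum θ α / α - c :=
      div_mul_cancel₀ _ hα1.ne'
    have h2 : x + ε + (logPowerSum θ α - (x - ε)) / α = -c := by
      have h3 : x + ε + (logPowerSum θ α - (x - ε)) / α =
        ε * (1 + 1 / α) - ((1 / α - 1) * x - logPowerSum θ α / α) := by ring
      rw [h3, h1]
      ring
    rw [h2, one_mul]

theorem limsup_le_of_lt_guessworkRate (hpos : ∀ x, 0 < θ x) [Nonempty X]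
    (hG : IsOptimalGuesswork θ G) {F : Set ℝ} (hF : IsClosed F) {c d : ℝ} (hdc : d < c)
    (hc : ∀ x ∈ F, (c : EReal) < guessworkRate θ x) :
    limsup (fun n : ℕ => (((n : ℝ)⁻¹ : ℝ) : EReal) * ENNReal.log (guessworkLaw θ G n F)) atTop ≤
      ((-d : ℝ) : EReal) := by
  obtain ⟨C, hC, h⟩ := exists_guessworkLaw_le hpos hG hF hc
  refine limsup_le_of_le (by isBoundedDefault) ?_
  filter_upwards [eventually_ne_atTop 0, eventually_exp_mul_le (neg_lt_neg hdc)
    (show 0 < 1 / (C + 1) by positivity)] with n hn hexp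
  refine inv_mul_log_le hn ((h n hn).trans (ENNReal.ofReal_le_ofReal ?_))
  rw [one_div, le_inv_mul_iff₀ (by positivity)] at hexp
  have := Real.exp_pos ((n : ℝ) * (-c))
  linarith

theorem le_liminf_of_guessworkRate_le (hpos : ∀ x, 0 < θ x) (hcard : 0 < Real.log (Fintype.card X))
    [Nonempty X] (hG : IsOptimalGuesswork θ G) {U : Set ℝ} (hU : IsOpen U) {x r c : ℝ}
    (hx : x ∈ U) (hr : guessworkRate θ x ≤ r) (hc : c < -r) :
    (c : EReal) ≤
      liminf (fun n : ℕ => (((n : ℝ)⁻¹ : ℝ) : EReal) * ENNReal.log (guessworkLaw θ G n U)) atTop := by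
  have hx0 : 0 ≤ x := by
    by_contra! hx0
    rw [guessworkRate, if_pos hx0, top_le_iff] at hr
    exact EReal.coe_ne_top r hr
  rw [guessworkRate_le_coe_iff hx0] at hr
  refine le_liminf_of_le (by isBoundedDefault) ?_
  rcases hx0.eq_or_lt with rfl | hx0
  -- At exponent 0 the first guess alone suffices: it has probability at least θ(x₀)^n, and large α
  -- in `hr` forces -r ≤ log θ(x₀).
  · obtain ⟨x₀, hx₀⟩ := Finite.exists_max θ
    have hle : ∀ α, 0 < α → -α * (Real.log (θ x₀) + r) ≤ Real.log (Fintype.card X) := by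
      intro α hα
      have h1 := hr α hα
      have h2 : logPowerSum θ α ≤ Real.log (Fintype.card X) + α * Real.log (θ x₀) := by
        rw [← Real.log_rpow (hpos x₀), ← Real.log_mul (by simp)
          (Real.rpow_pos_of_pos (hpos x₀) α).ne']
        refine Real.log_le_log (powerSum_pos hpos α) ?_
        rw [← nsmul_eq_mul]
        exact Finset.sum_le_card_nsmul _ _ _ fun z _ =>
          Real.rpow_le_rpow (hpos z).le (hx₀ z) hα.le
      linarith
    have hM : -r ≤ Real.log (θ x₀) := by
      by_contra! hlt
      have h3 : 0 < -(Real.log (θ x₀) + r) := by linarith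
      have h4 := hle ((Real.log (Fintype.card X) + 1) / -(Real.log (θ x₀) + r)) (by positivity)
      rw [neg_mul_comm, div_mul_cancel₀ _ h3.ne'] at h4
      linarith
    filter_upwards [eventually_ne_atTop 0] with n hn
    refine (EReal.coe_le_coe_iff.mpr (hc.le.trans hM)).trans
      (le_inv_mul_log hn (hG.pow_le_guessworkLaw hpos hU.measurableSet hx n x₀))
  · have hxcard : x ≤ Real.log (Fintype.card X) := by
      have h1 : Tendsto (fun α => logPowerSum θ α + α * (x + r)) (𝓝[>] 0)
          (𝓝 (logPowerSum θ 0 + 0 * (x + r))) :=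
        (((differentiable_logPowerSum hpos).continuous.add
          (continuous_id.mul continuous_const)).tendsto 0).mono_left nhdsWithin_le_nhds
      rw [logPowerSum_zero, zero_mul, add_zero] at h1
      exact ge_of_tendsto h1 (by filter_upwards [self_mem_nhdsWithin] with α hα using hr α hα)
    obtain ⟨l, hl, hlU⟩ := exists_Ioc_subset_of_mem_nhds (hU.mem_nhds hx) ⟨0, hx0⟩
    set e := -r - c with he
    have he0 : 0 < e := by linarith
    set m := max l (max 0 (x - e / 3)) with hm
    have hmx : m < x := max_lt hl (max_lt hx0 (by linarith))
    have hlm : l ≤ m := le_max_left _ _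
    have h0m : 0 ≤ m := (le_max_left _ _).trans (le_max_right _ _)
    have hem : x - e / 3 ≤ m := (le_max_right _ _).trans (le_max_right _ _)
    -- Moving strictly below x gives y < log|X| even when x = log|X|. As m ≥ x - e / 3, this and the
    -- slack in L cost less than e in total.
    set y := (m + x) / 2 with hy
    have hev := hG.eventually_le_guessworkLaw hpos hU.measurableSet (y := y) (ε := y - m)
      (L := x + r + e / 3) (δ := e / 3) (by linarith) (by linarith) (by linarith)
      ((Set.Ioc_subset_Ioc (by linarith) (by linarith)).trans hlU) (by linarith)
      (fun α hα => by
        have h1 := hr α hα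
        rw [add_sub_cancel_right]
        linarith)
    filter_upwards [hev, eventually_ne_atTop 0, eventually_exp_mul_le (C := 1 / 2)
      (show c < y - (x + r + e / 3) by linarith) (by norm_num)] with n hn hn0 hexp
    exact le_inv_mul_log hn0 ((ENNReal.ofReal_le_ofReal hexp).trans hn)

theorem satisfiesLDP_guessworkRate (hpos : ∀ x, 0 < θ x) (hsum : ∑ x, θ x = 1)
    (hcard : 0 < Real.log (Fintype.card X)) [Nonempty X] (hG : IsOptimalGuesswork θ G) :
    SatisfiesLDP (guessworkLaw θ G) (guessworkRate θ) where
  nonneg := guessworkRate_nonneg hsum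
  lowerSemicontinuous := lowerSemicontinuous_guessworkRate θ
  lower_bound U hU := by
    refine EReal.ge_of_forall_gt_iff_ge.mp fun c hc => ?_
    rw [EReal.lt_neg_comm, iInf_lt_iff] at hc
    obtain ⟨x, hc⟩ := hc
    obtain ⟨hx, hxc⟩ := iInf_lt_iff.mp hc
    obtain ⟨r, hr, hrc⟩ := EReal.lt_iff_exists_real_btwn.mp hxc
    rw [← EReal.coe_neg, EReal.coe_lt_coe_iff] at hrc
    exact le_liminf_of_guessworkRate_le hpos hcard hG hU hx hr.le (by linarith)
  upper_bound F hF := by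
    refine EReal.le_of_forall_lt_iff_le.mp fun c hc => ?_
    rw [EReal.neg_lt_comm] at hc
    obtain ⟨b, hb, hbF⟩ := EReal.lt_iff_exists_real_btwn.mp hc
    rw [← EReal.coe_neg, EReal.coe_lt_coe_iff] at hb
    have := limsup_le_of_lt_guessworkRate hpos hG hF hb
      fun x hx => hbF.trans_le (iInf₂_le x hx)
    rwa [neg_neg] at this

theorem SatisfiesLDP.rateFunction_eq {μ : ℕ → Measure ℝ} {I : ℝ → EReal} (h : SatisfiesLDP μ I) :
    rateFunction μ = I :=
  (Classical.epsilon_spec (p := SatisfiesLDP μ) ⟨I, h⟩).unique h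

/-! ### The uniform rate and the strict comparison. -/

theorem guessworkRate_uniformSource [Nonempty X] {x : ℝ} (hx : 0 ≤ x)
    (hxc : x ≤ Real.log (Fintype.card X)) :
    guessworkRate (uniformSource X) x = ((Real.log (Fintype.card X) - x : ℝ) : EReal) := by
  have hcard : (0 : ℝ) < Fintype.card X := by exact_mod_cast Fintype.card_pos
  have hφ : ∀ α, logPowerSum (uniformSource X) α = (1 - α) * Real.log (Fintype.card X) := by
    intro α
    simp only [logPowerSum, uniformSource, Finset.sum_const, Finset.card_univ, nsmul_eq_mul]
    rw [Real.log_mul hcard.ne' (Real.rpow_pos_of_pos (by positivity) α).ne',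
      Real.log_rpow (by positivity), one_div, Real.log_inv]
    ring
  refine le_antisymm ((guessworkRate_le_coe_iff hx).mpr fun α hα => ?_) ?_
  · rw [hφ]
    linarith
  · refine EReal.ge_of_forall_gt_iff_ge.mp fun r hr => ?_
    rw [EReal.coe_lt_coe_iff] at hr
    refine ((coe_lt_guessworkRate_iff hx).mpr ?_).le
    set d := Real.log (Fintype.card X) - x with hd
    -- The expression equals d - d / α and tends to d as α → ∞. The added 1 keeps α positive when d
    -- = 0.
    refine ⟨(d + 1) / (d - r), div_pos (by linarith) (by linarith), ?_⟩
    rw [hφ]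
    have h1 : 0 < d - r := by linarith
    have h2 : 0 < d + 1 := by linarith
    have h3 : (1 / ((d + 1) / (d - r)) - 1) * x - (1 - (d + 1) / (d - r)) *
        Real.log (Fintype.card X) / ((d + 1) / (d - r)) = d - d * ((d - r) / (d + 1)) := by
      rw [show Real.log (Fintype.card X) = d + x by rw [hd]; ring]
      field_simp
      ring
    rw [h3]
    have h4 : d * ((d - r) / (d + 1)) < d - r := by
      rw [← mul_div_assoc, div_lt_iff₀ h2]
      linarith
    linarith

theorem entropy_eq (θ : X → ℝ) : entropy θ = -∑ x, θ x * Real.log (θ x) := by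
  simp [entropy]

/-- Jensen for exp under θ, since ∑ θ_x^α is the θ-mean of exp((α - 1) log θ_x). -/
theorem entropy_mul_le_logPowerSum (hpos : ∀ x, 0 < θ x) (hsum : ∑ x, θ x = 1) [Nonempty X]
    (α : ℝ) : (1 - α) * entropy θ ≤ logPowerSum θ α := by
  rw [logPowerSum, Real.le_log_iff_exp_le (powerSum_pos hpos α)]
  have h := convexOn_exp.map_sum_le (t := Finset.univ) (w := θ)
    (p := fun x => (α - 1) * Real.log (θ x)) (fun x _ => (hpos x).le) hsum (fun _ _ => trivial)
  simp only [smul_eq_mul] at h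
  have h1 : ∑ x, θ x * ((α - 1) * Real.log (θ x)) = (1 - α) * entropy θ := by
    rw [entropy_eq, mul_neg, ← neg_mul, neg_sub, Finset.mul_sum]
    exact Finset.sum_congr rfl fun x _ => by ring
  have h2 : ∑ x, θ x * Real.exp ((α - 1) * Real.log (θ x)) = ∑ x, θ x ^ α := by
    refine Finset.sum_congr rfl fun x _ => ?_
    rw [mul_comm (α - 1), ← Real.rpow_def_of_pos (hpos x), Real.rpow_sub_one (hpos x).ne',
      mul_div_cancel₀ _ (hpos x).ne']
  rwa [h1, h2] at h

/-- Entropy is the θ-mean of -log θ_x. If no value lies below the mean, all values equal it, and θ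
is constant. -/
theorem exists_neg_log_lt_entropy (hpos : ∀ x, 0 < θ x) (hsum : ∑ x, θ x = 1)
    (hne : θ ≠ uniformSource X) [Nonempty X] : ∃ x, -Real.log (θ x) < entropy θ := by
  by_contra! hle
  refine hne ?_
  have hterm : ∀ x, 0 ≤ θ x * (-Real.log (θ x) - entropy θ) := fun x =>
    mul_nonneg (hpos x).le (by linarith [hle x])
  have hzero : ∑ x, θ x * (-Real.log (θ x) - entropy θ) = 0 := by
    simp only [mul_sub, mul_neg, Finset.sum_sub_distrib, Finset.sum_neg_distrib, ← Finset.sum_mul,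
      hsum, one_mul, entropy_eq]
    ring
  have hconst : ∀ x, θ x = Real.exp (-entropy θ) := by
    intro x
    have h1 := (Finset.sum_eq_zero_iff_of_nonneg fun x _ => hterm x).mp hzero x (Finset.mem_univ x)
    have h2 := (mul_eq_zero.mp h1).resolve_left (hpos x).ne'
    rw [← Real.exp_log (hpos x)]
    congr 1
    linarith
  funext x
  have h3 : (Fintype.card X : ℝ) * Real.exp (-entropy θ) = 1 := by
    rw [← hsum, Finset.sum_congr rfl fun x _ => hconst x]
    simp
  rw [hconst, uniformSource]
  exact eq_one_div_of_mul_eq_one_right h3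

theorem exists_guessworkRate_le (hpos : ∀ x, 0 < θ x) (hsum : ∑ x, θ x = 1)
    (hne : θ ≠ uniformSource X) [Nonempty X] {x : ℝ} (hx : 0 < x) (hxH : x < entropy θ) :
    ∃ c < entropy θ, guessworkRate θ x ≤ ((c - x : ℝ) : EReal) := by
  obtain ⟨z, hz⟩ := exists_neg_log_lt_entropy hpos hsum hne
  set H := entropy θ with hH
  set c₀ := (H - Real.log (θ z)) / 2 with hc₀
  have hc₀z : 0 < c₀ + Real.log (θ z) := by linarith
  -- The threshold between the two regimes: for α ≥ A the letter z gives α * (c₀ + log θ_z) ≥ x; for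
  -- α ≤ A the tangent bound loses at most A * ((H - x) / A) = H - x.
  set A := x / (c₀ + Real.log (θ z)) with hA
  have hA0 : 0 < A := div_pos hx hc₀z
  have hgap : 0 < (H - x) / A := div_pos (by linarith) hA0
  refine ⟨max c₀ (H - (H - x) / A), max_lt (by linarith) (by linarith),
    (guessworkRate_le_coe_iff hx.le).mpr fun α hα => ?_⟩
  rw [add_sub_cancel]
  rcases le_total A α with h | h
  · have h1 := mul_log_le_logPowerSum hpos z α
    have h2 : α * c₀ ≤ α * max c₀ (H - (H - x) / A) :=
      mul_le_mul_of_nonneg_left (le_max_left _ _) hα.le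
    have h3 : x ≤ α * (c₀ + Real.log (θ z)) := (div_le_iff₀ hc₀z).mp h
    linarith
  · have h1 := entropy_mul_le_logPowerSum hpos hsum α
    have h2 : α * (H - (H - x) / A) ≤ α * max c₀ (H - (H - x) / A) :=
      mul_le_mul_of_nonneg_left (le_max_right _ _) hα.le
    have h3 : α * ((H - x) / A) ≤ A * ((H - x) / A) := mul_le_mul_of_nonneg_right h hgap.le
    rw [mul_div_cancel₀ _ hA0.ne'] at h3
    linarith

theorem nonempty_of_sum_eq_one (hsum : ∑ x, θ x = 1) : Nonempty X := by
  by_contra h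
  rw [not_nonempty_iff] at h
  simp at hsum

theorem log_card_pos_of_ne_uniformSource (hsum : ∑ x, θ x = 1) (hne : θ ≠ uniformSource X)
    [Nonempty X] : 0 < Real.log (Fintype.card X) := by
  refine Real.log_pos (Nat.one_lt_cast.mpr ?_)
  by_contra! hle
  have h1 : Fintype.card X = 1 := le_antisymm hle Fintype.card_pos
  obtain ⟨a, ha⟩ := Fintype.card_eq_one_iff.mp h1
  refine hne (funext fun x => ?_)
  have : Subsingleton X := Fintype.card_le_one_iff_subsingleton.mp hle
  rw [Fintype.sum_subsingleton _ x] at hsum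
  rw [hsum, uniformSource, h1, Nat.cast_one, div_one]

end

end Guesswork

open Guesswork in
theorem mainTheorem4 {X : Type*} [Fintype X] (θ : X → ℝ)
    (hpos : ∀ x, 0 < θ x) (hsum : ∑ x, θ x = 1) (hne : θ ≠ uniformSource X)
    (Gu : (n : ℕ) → (Fin n → X) → ℕ) (hGu : IsOptimalGuesswork (uniformSource X) Gu)
    (Gθ : (n : ℕ) → (Fin n → X) → ℕ) (hGθ : IsOptimalGuesswork θ Gθ)
    (η : ℝ) (hη : η = entropy θ / Real.log (Fintype.card X)) :
    SatisfiesLDP (guessworkLaw (uniformSource X) Gu)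
        (rateFunction (guessworkLaw (uniformSource X) Gu)) ∧
    SatisfiesLDP (guessworkLaw θ Gθ) (rateFunction (guessworkLaw θ Gθ)) ∧
    ∀ g : ℝ, 0 < g → g < Real.log (Fintype.card X) →
      rateFunction (guessworkLaw (uniformSource X) Gu) g
          = ((Real.log (Fintype.card X) - g : ℝ) : EReal) ∧
      ((1 / η : ℝ) : EReal) * rateFunction (guessworkLaw θ Gθ) (η * g)
          < rateFunction (guessworkLaw (uniformSource X) Gu) g := by
  have := nonempty_of_sum_eq_one hsum
  have hcard := log_card_pos_of_ne_uniformSource hsum hne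
  have hcard0 : (0 : ℝ) < Fintype.card X := by exact_mod_cast Fintype.card_pos
  have hu := satisfiesLDP_guessworkRate (θ := uniformSource X) (fun _ => one_div_pos.mpr hcard0)
    (by simp [uniformSource, hcard0.ne']) hcard hGu
  have hθ := satisfiesLDP_guessworkRate hpos hsum hcard hGθ
  rw [hu.rateFunction_eq, hθ.rateFunction_eq]
  refine ⟨hu, hθ, fun g hg hgc => ?_⟩
  have huniform := guessworkRate_uniformSource (X := X) hg.le hgc.le
  refine ⟨huniform, ?_⟩
  rw [huniform]
  have hH : 0 < entropy θ := by
    obtain ⟨z, hz⟩ := exists_neg_log_lt_entropy hpos hsum hne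
    have h1 : θ z ≤ 1 := hsum ▸ Finset.single_le_sum (fun x _ => (hpos x).le) (Finset.mem_univ z)
    linarith [Real.log_nonpos (hpos z).le h1]
  have hη0 : 0 < η := hη ▸ div_pos hH hcard
  have hηH : η * Real.log (Fintype.card X) = entropy θ := by
    rw [hη, div_mul_cancel₀ _ hcard.ne']
  obtain ⟨c, hc, hle⟩ := exists_guessworkRate_le hpos hsum hne (mul_pos hη0 hg)
    (hηH ▸ mul_lt_mul_of_pos_left hgc hη0)
  refine (mul_le_mul_of_nonneg_left hle (EReal.coe_nonneg.mpr (one_div_pos.mpr hη0).le)).trans_lt ?_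
  -- After multiplying by η, with η log|X| = H, only c < H remains.
  rw [← EReal.coe_mul, EReal.coe_lt_coe_iff, one_div, inv_mul_lt_iff₀ hη0, mul_sub, hηH]
  linarith
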